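/- For a commutative ring $R$ let $\mathfrak{G}^1_+(R)$ be the set of formal power series $f=z+\sum_{n\ge 2} r_n z^n$ with $r_n\in R$. Write $X_n(f)$ for the coefficient of $z^n$ in $f$. For a partition $\pi$ of $\{1,\dots,n\}$ put $X_{n,\pi}(f)=\prod_{V\in\pi}X_{|V|}(f)$, the product running over the blocks of $\pi$. The boxed convolution of $f,g\in\mathfrak{G}^1_+(R)$ is the series $f\boxtimes g$ without constant term given by $$X_n(f\boxtimes g)=\sum_{\pi\in \mathrm{NC}(n)}X_{n,\pi}(f)\,X_{n,K(\pi)}(g)\qquad(n\ge 1),$$ where $\mathrm{NC}(n)$ is the set of non-crossing partitions of $\{1,\dots,n\}$ and $K(\pi)$ is the Kreweras complement of $\pi$. Let $\mathbb{G}_a^{\mathbb{N}}(R)$ be the additive group of all sequences $(a_n)_{n\in\mathbb{N}}$ in $R$, with coordinatewise addition. Theorem. For every commutative $\mathbb{Q}$-algebra $R$, $(\mathfrak{G}^1_+(R),\boxtimes)$ is a commutative group with neutral element $z$, and the formal groups $(\mathfrak{G}^1_+,\boxtimes)$ and $\mathbb{G}_a^{\mathbb{N}}$ are isomorphic over $\mathbb{Q}$.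 That is, there are group isomorphisms $$e_R\colon(\mathfrak{G}^1_+(R),\boxtimes)\longrightarrow\mathbb{G}_a^{\mathbb{N}}(R),$$ one for every commutative $\mathbb{Q}$-algebra $R$, which are natural in $R$ with respect to $\mathbb{Q}$-algebra homomorphisms, and there are polynomials $\Phi_n,\Psi_n\in\mathbb{Q}[t_0,t_1,t_2,\dots]$ $(n\in\mathbb{N})$, independent of $R$, such that for all $R$, all $f=z+\sum_{n\ge2}r_nz^n\in\mathfrak{G}^1_+(R)$, all sequences $a=(a_0,a_1,\dots)$ in $R$ and all $n\in\mathbb{N}$ $$e_R(f)_n=\Phi_n(r_2,r_3,r_4,\dots),\qquad X_{n+2}\big(e_R^{-1}(a)\big)=\Psi_n(a_0,a_1,a_2,\dots).$$ -/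

import Mathlib

open Finset PowerSeries

universe u

/-- Set partitions of the linearly ordered set of `n` positions. -/
abbrev SetPartition (n : ℕ) : Type := Finpartition (Finset.univ : Finset (Fin n))

/-- A relation on a linear order is non-crossing if `a < b < c < d`, `a ∼ c` and `b ∼ d` force
`a ∼ b`. For an equivalence relation: no two distinct classes cross. -/
def NonCrossingRel {α : Type*} [LT α] (r : α → α → Prop) : Prop :=
  ∀ a b c d : α, a < b → b < c → c < d → r a c → r b d → r a b

namespace SetPartition

/-- `a` and `b` lie in the same block of `P`. -/
def Rel {n : ℕ} (P : SetPartition n) (a b : Fin n) : Prop := P.part a = P.part b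

instance {n : ℕ} (P : SetPartition n) : DecidableRel P.Rel :=
  fun a b => inferInstanceAs (Decidable (P.part a = P.part b))

/-- Non-crossing partitions of `Fin n`. -/
def IsNonCrossing {n : ℕ} (P : SetPartition n) : Prop := NonCrossingRel P.Rel

instance {n : ℕ} (P : SetPartition n) : Decidable P.IsNonCrossing :=
  inferInstanceAs (Decidable (∀ a b c d : Fin n, a < b → b < c → c < d →
    P.Rel a c → P.Rel b d → P.Rel a b))

/-- Two positions `i ≤ j` are in relation if no block of `P` meets both the interval
`{i + 1, …, j}` and its complement. Here `¬ (a ≤ i ↔ a ≤ j)` says that `a` lies in the interval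
between `i` (excluded) and `j` (included), whichever of `i`, `j` is the smaller. -/
def krewerasSetoid {n : ℕ} (P : SetPartition n) : Setoid (Fin n) where
  r i j := ∀ a b : Fin n, P.Rel a b → ((a ≤ i ↔ a ≤ j) ↔ (b ≤ i ↔ b ≤ j))
  iseqv :=
    { refl := fun i a b _ => by tauto
      symm := fun h a b hab => by have := h a b hab; tauto
      trans := fun h h' a b hab => by have := h a b hab; have := h' a b hab; tauto }

instance {n : ℕ} (P : SetPartition n) : DecidableRel (krewerasSetoid P).r :=
  fun i j => inferInstanceAs
    (Decidable (∀ a b : Fin n, P.Rel a b → ((a ≤ i ↔ a ≤ j) ↔ (b ≤ i ↔ b ≤ j))))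

/-- The Kreweras complement of `P`. That it is the usual one is shown in `isGreatest_kreweras`. -/
def kreweras {n : ℕ} (P : SetPartition n) : SetPartition n :=
  Finpartition.ofSetoid (krewerasSetoid P)

/-- The union of `P`, living on the points `(i, false)`, and `Q`, living on the points
`(i, true)`, of the set `1 < 1' < 2 < 2' < ⋯ < n < n'` of `2 n` interleaved points. -/
def interleave {n : ℕ} (P Q : SetPartition n) (x y : Fin n ×ₗ Bool) : Prop :=
  ((ofLex x).2 = false ∧ (ofLex y).2 = false ∧ P.Rel (ofLex x).1 (ofLex y).1) ∨
    ((ofLex x).2 = true ∧ (ofLex y).2 = true ∧ Q.Rel (ofLex x).1 (ofLex y).1)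

theorem rel_kreweras {n : ℕ} (P : SetPartition n) (i j : Fin n) :
    P.kreweras.Rel i j ↔
      ∀ a b : Fin n, P.Rel a b → ((a ≤ i ↔ a ≤ j) ↔ (b ≤ i ↔ b ≤ j)) := by
  have h := Finpartition.mem_part_iff_part_eq_part P.kreweras
    (Finset.mem_univ i) (Finset.mem_univ j)
  rw [Rel, ← h, kreweras, Finpartition.mem_part_ofSetoid_iff_rel]
  exact ⟨fun h => (krewerasSetoid P).symm h, fun h => (krewerasSetoid P).symm h⟩

theorem le_of_rel {n : ℕ} (P Q : SetPartition n)
    (h : ∀ i j : Fin n, P.Rel i j → Q.Rel i j) : P ≤ Q := by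
  intro V hV
  obtain ⟨i, hi⟩ := Finpartition.nonempty_of_mem_parts P hV
  refine ⟨Q.part i, Q.part_mem.2 (Finset.mem_univ i), ?_⟩
  intro j hj
  have h1 : P.Rel j i := by
    rw [Rel, P.part_eq_of_mem hV hi, P.part_eq_of_mem hV hj]
  exact (Finpartition.mem_part_iff_part_eq_part Q (Finset.mem_univ j) (Finset.mem_univ i)).2
    (h j i h1)

theorem isNonCrossing_kreweras {n : ℕ} (P : SetPartition n) : P.kreweras.IsNonCrossing := by
  intro i j k l hij hjk hkl h1 h2
  rw [rel_kreweras] at *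
  intro a b hab
  have h3 := h1 a b hab
  have h4 := h2 a b hab
  grind

/-- The Kreweras complement of a non-crossing partition `P` is the largest non-crossing partition
`Q` of `1', …, n'` such that `P ∪ Q` is a non-crossing partition of `1, 1', …, n, n'`. -/
theorem isGreatest_kreweras {n : ℕ} (P : SetPartition n) (hP : P.IsNonCrossing) :
    IsGreatest {Q : SetPartition n | Q.IsNonCrossing ∧ NonCrossingRel (interleave P Q)}
      P.kreweras := by
  refine ⟨⟨isNonCrossing_kreweras P, ?_⟩, ?_⟩
  · intro a b c d hab hbc hcd hac hbd
    rw [Prod.Lex.lt_iff] at hab hbc hcd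
    unfold interleave at *
    rcases hac with ⟨ha, hc, hac⟩ | ⟨ha, hc, hac⟩ <;>
      rcases hbd with ⟨hb, hd, hbd⟩ | ⟨hb, hd, hbd⟩ <;>
      simp only [ha, hb, hc, hd, lt_self_iff_false, and_false, or_false,
        and_true, Bool.lt_iff, reduceCtorEq, true_and, false_and, false_or] at hab hbc hcd ⊢
    · exact hP _ _ _ _ hab hbc hcd hac hbd
    · have := (rel_kreweras P _ _).1 hbd _ _ hac
      grind
    · have := (rel_kreweras P _ _).1 hac _ _ hbd
      grind
    · exact isNonCrossing_kreweras P _ _ _ _ hab hbc hcd hac hbd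
  · rintro Q ⟨-, hQ⟩
    have key : ∀ i j : Fin n, Q.Rel i j → ∀ a b : Fin n, P.Rel a b →
        i < a → a ≤ j → b ≤ i ∨ j < b → False := by
      intro i j hij a b hab h1 h2 h3
      rcases h3 with h3 | h3
      · have := hQ (toLex (b, false)) (toLex (i, true)) (toLex (a, false)) (toLex (j, true))
          (by simp [Prod.Lex.lt_iff, h3.lt_or_eq]) (by simp [Prod.Lex.lt_iff, h1])
          (by simp [Prod.Lex.lt_iff, h2.lt_or_eq]) (Or.inl ⟨rfl, rfl, hab.symm⟩)
          (Or.inr ⟨rfl, rfl, hij⟩)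
        simp [interleave] at this
      · have := hQ (toLex (i, true)) (toLex (a, false)) (toLex (j, true)) (toLex (b, false))
          (by simp [Prod.Lex.lt_iff, h1]) (by simp [Prod.Lex.lt_iff, h2.lt_or_eq])
          (by simp [Prod.Lex.lt_iff, h3]) (Or.inr ⟨rfl, rfl, hij⟩) (Or.inl ⟨rfl, rfl, hab⟩)
        simp [interleave] at this
    apply le_of_rel
    intro i j hij
    rw [rel_kreweras]
    intro a b hab
    have k1 := key i j hij a b hab
    have k2 := key i j hij b a hab.symm
    have k3 := key j i hij.symm a b hab
    have k4 := key j i hij.symm b a hab.symm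
    grind

end SetPartition

/-- The set `NC(n)` of non-crossing partitions. -/
def NC (n : ℕ) : Finset (SetPartition n) := Finset.univ.filter SetPartition.IsNonCrossing

/-- The coefficient of a series in one variable along a partition: the product over the blocks
`V` of the coefficients in degree `|V|`. -/
noncomputable def coeffAlong {R : Type*} [CommRing R] {n : ℕ} (π : SetPartition n) (f : R⟦X⟧) : R :=
  ∏ V ∈ π.parts, coeff V.card f

/-- The boxed convolution of two one-variable series (the result has no constant term). -/
noncomputable def boxedConv {R : Type*} [CommRing R] (f g : R⟦X⟧) : R⟦X⟧ :=
  PowerSeries.mk fun n =>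
    if n = 0 then 0 else ∑ π ∈ NC n, coeffAlong π f * coeffAlong π.kreweras g

/-- The set `𝔊¹₊(R)` of the series `z + r₂ z² + r₃ z³ + ⋯` with coefficients in `R`. -/
def GOnePlus (R : Type*) [CommRing R] : Type _ :=
  {f : R⟦X⟧ // coeff 0 f = 0 ∧ coeff 1 f = 1}

namespace GOnePlus

theorem coeffAlong_one {R : Type*} [CommRing R] (π : SetPartition 1) (f : R⟦X⟧) :
    coeffAlong π f = coeff 1 f := by
  have hsub : π = ⊤ := by
    have := π.parts_nonempty (by simp)
    decide +revert
  subst hsub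
  rw [coeffAlong, show (⊤ : SetPartition 1).parts = {Finset.univ} from by decide]
  simp

theorem NC_one : (NC 1).card = 1 := by decide

/-- Boxed convolution as the multiplication of `𝔊¹₊(R)`. -/
noncomputable instance (R : Type*) [CommRing R] : Mul (GOnePlus R) where
  mul f g := ⟨boxedConv f.1 g.1, by simp [boxedConv], by
    simp [boxedConv, coeffAlong_one, f.2.2, g.2.2, NC_one]⟩

/-- Functoriality of `𝔊¹₊`: apply a ring homomorphism to all coefficients. -/
noncomputable def map {R S : Type*} [CommRing R] [CommRing S] (φ : R →+* S) (f : GOnePlus R) : GOnePlus S :=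
  ⟨PowerSeries.map φ f.1, by simp [f.2.1], by simp [f.2.2]⟩

/-- The coordinates `(r₂, r₃, …)` of `z + r₂ z² + r₃ z³ + ⋯`, numbered from zero. -/
noncomputable def coords {R : Type*} [CommRing R] (f : GOnePlus R) (n : ℕ) : R :=
  coeff (n + 2) f.1

end GOnePlus

/-- The additive group `𝔾ₐ^ℕ(R)`: all sequences in `R` with coordinatewise addition, written
multiplicatively. -/
abbrev GaN (R : Type*) [CommRing R] : Type _ := Multiplicative (ℕ → R)

universe v

/-- The relation on `ℕ` given by a set partition of `n` positions. -/
def SetPartition.natRel {n : ℕ} (P : SetPartition n) (x y : ℕ) : Prop :=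
  ∃ (hx : x < n) (hy : y < n), P.Rel ⟨x, hx⟩ ⟨y, hy⟩

/-- `r` is an equivalence relation on `{0, …, n - 1}`, extended by `False` to `ℕ`. -/
structure IsPartRel (n : ℕ) (r : ℕ → ℕ → Prop) : Prop where
  lt : ∀ x y, r x y → x < n
  refl : ∀ x, x < n → r x x
  symm : ∀ x y, r x y → r y x
  trans : ∀ x y z, r x y → r y z → r x z

/-- Put `r₂` to the right of `r₁` and of a new point `i`, which joins the class of `0`. -/
def glueRel (i : ℕ) (r₁ r₂ : ℕ → ℕ → Prop) (x y : ℕ) : Prop :=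
  (x < i ∧ y < i ∧ r₁ x y) ∨ (x = i ∧ y = i) ∨ (x = i ∧ y < i ∧ r₁ 0 y) ∨
    (x < i ∧ y = i ∧ r₁ x 0) ∨ (i < x ∧ i < y ∧ r₂ (x - (i + 1)) (y - (i + 1)))

/-- The relation of the Kreweras complement, read from right to left. -/
def krewRel (n : ℕ) (r : ℕ → ℕ → Prop) (x y : ℕ) : Prop :=
  x < n ∧ y < n ∧ ∀ a b, r a b →
    ((a ≤ n - 1 - x ↔ a ≤ n - 1 - y) ↔ (b ≤ n - 1 - x ↔ b ≤ n - 1 - y))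

theorem isPartRel_natRel {n : ℕ} (P : SetPartition n) : IsPartRel n P.natRel where
  lt := fun _ _ h => h.1
  refl := fun _ h => ⟨h, h, rfl⟩
  symm := fun _ _ ⟨h, h', e⟩ => ⟨h', h, e.symm⟩
  trans := fun _ _ _ ⟨h, _, e⟩ ⟨_, h', e'⟩ => ⟨h, h', e.trans e'⟩

theorem natRel_injective {n : ℕ} : Function.Injective (SetPartition.natRel (n := n)) := by
  intro P Q h
  have key : ∀ i j : Fin n, P.Rel i j ↔ Q.Rel i j := fun i j => by
    have := congrFun (congrFun h i) j
    simpa [SetPartition.natRel] using this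
  exact le_antisymm (SetPartition.le_of_rel _ _ fun i j => (key i j).1)
    (SetPartition.le_of_rel _ _ fun i j => (key i j).2)

theorem exists_natRel_eq {n : ℕ} {r : ℕ → ℕ → Prop} (h : IsPartRel n r) :
    ∃ P : SetPartition n, P.natRel = r := by
  classical
  let s : Setoid (Fin n) :=
    ⟨fun i j => r i j, fun i => h.refl _ i.2, fun h' => h.symm _ _ h',
      fun h1 h2 => h.trans _ _ _ h1 h2⟩
  refine ⟨Finpartition.ofSetoid s, ?_⟩
  funext x y
  have key : ∀ i j : Fin n, SetPartition.Rel (Finpartition.ofSetoid s) i j ↔ r i j := by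
    intro i j
    rw [SetPartition.Rel, ← Finpartition.mem_part_iff_part_eq_part _ (mem_univ i) (mem_univ j),
      Finpartition.mem_part_ofSetoid_iff_rel]
    exact ⟨h.symm _ _, h.symm _ _⟩
  apply propext
  constructor
  · rintro ⟨hx, hy, h'⟩
    exact (key _ _).1 h'
  · intro h'
    exact ⟨h.lt _ _ h', h.lt _ _ (h.symm _ _ h'), (key _ _).2 h'⟩

theorem nonCrossingRel_natRel {n : ℕ} (P : SetPartition n) :
    NonCrossingRel P.natRel ↔ P.IsNonCrossing := by
  constructor
  · intro h a b c d hab hbc hcd hac hbd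
    obtain ⟨_, _, h'⟩ := h a b c d hab hbc hcd ⟨a.2, c.2, hac⟩ ⟨b.2, d.2, hbd⟩
    exact h'
  · rintro h a b c d hab hbc hcd ⟨ha, hc, hac⟩ ⟨hb, hd, hbd⟩
    exact ⟨ha, hb, h ⟨a, ha⟩ ⟨b, hb⟩ ⟨c, hc⟩ ⟨d, hd⟩ hab hbc hcd hac hbd⟩

theorem mem_NC_iff {n : ℕ} (P : SetPartition n) : P ∈ NC n ↔ NonCrossingRel P.natRel := by
  simp [NC, nonCrossingRel_natRel]

theorem natRel_kreweras {n : ℕ} (P : SetPartition n) (x y : ℕ) :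
    krewRel n P.natRel x y ↔ x < n ∧ y < n ∧ P.kreweras.natRel (n - 1 - x) (n - 1 - y) := by
  unfold krewRel
  refine and_congr_right fun hx => and_congr_right fun hy => ?_
  constructor
  · intro h
    refine ⟨by omega, by omega, (SetPartition.rel_kreweras _ _ _).2 fun a b hab => ?_⟩
    exact h a b ⟨a.2, b.2, hab⟩
  · rintro ⟨h1, h2, h⟩ a b ⟨ha, hb, hab⟩
    exact (SetPartition.rel_kreweras _ _ _).1 h _ _ hab

theorem IsPartRel.glue {i j : ℕ} {r₁ r₂ : ℕ → ℕ → Prop} (h₁ : IsPartRel i r₁)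
    (h₂ : IsPartRel j r₂) : IsPartRel (i + 1 + j) (glueRel i r₁ r₂) where
  lt := fun x y h => by
    have := h₂.lt (x - (i + 1)) (y - (i + 1))
    unfold glueRel at h; grind
  refl := fun x h => by
    have := h₁.refl x
    have := h₂.refl (x - (i + 1))
    unfold glueRel
    rcases lt_trichotomy x i with hx | hx | hx <;> grind
  symm := fun x y h => by
    have := h₁.symm
    have := h₂.symm
    unfold glueRel at *; grind
  trans := fun x y z h h' => by
    have := h₁.symm
    have := h₁.trans
    have := h₂.trans
    unfold glueRel at *
    rcases h with h | h | h | h | h <;> rcases h' with h' | h' | h' | h' | h' <;> grind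

theorem NonCrossingRel.glue {i : ℕ} {r₁ r₂ : ℕ → ℕ → Prop} (h₁ : IsPartRel i r₁)
    (hn₁ : NonCrossingRel r₁) (hn₂ : NonCrossingRel r₂) :
    NonCrossingRel (glueRel i r₁ r₂) := by
  intro a b c d hab hbc hcd hac hbd
  by_cases hd : d ≤ i
  · have hac' : r₁ a c := by unfold glueRel at hac; grind
    suffices r₁ a b by unfold glueRel; grind
    rcases hd.lt_or_eq with hd | hd
    · exact hn₁ a b c d hab hbc hcd hac' (by unfold glueRel at hbd; grind)
    · have hb : r₁ 0 b := h₁.symm _ _ (by unfold glueRel at hbd; grind)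
      rcases Nat.eq_zero_or_pos a with rfl | ha
      · exact hb
      · exact h₁.trans _ _ _ (h₁.symm _ _ (hn₁ 0 a b c ha hab hbc hb hac')) hb
  · have hb : i < b := by unfold glueRel at hbd; grind
    have ha : i < a := by unfold glueRel at hac; grind
    have := hn₂ (a - (i + 1)) (b - (i + 1)) (c - (i + 1)) (d - (i + 1)) (by omega) (by omega)
      (by omega) (by unfold glueRel at hac; grind) (by unfold glueRel at hbd; grind)
    unfold glueRel; grind

theorem glueRel_zero {i : ℕ} {r₁ r₂ : ℕ → ℕ → Prop} (h₁ : IsPartRel i r₁) :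
    glueRel i r₁ r₂ 0 i := by
  have := h₁.refl 0
  unfold glueRel; grind

theorem le_of_glueRel_zero {i y : ℕ} {r₁ r₂ : ℕ → ℕ → Prop} (h : glueRel i r₁ r₂ 0 y) :
    y ≤ i := by
  unfold glueRel at h; grind

theorem iff_of_glueRel_right {i j a b : ℕ} {r₁ r₂ : ℕ → ℕ → Prop} {p q : ℕ → Prop}
    (h₂ : IsPartRel j r₂)
    (hp : ∀ t ≤ i, p t) (hpq : ∀ t, i < t → t - (i + 1) < j → (p t ↔ q (t - (i + 1))))
    (h : ∀ a b, r₂ a b → (q a ↔ q b)) (hab : glueRel i r₁ r₂ a b) : p a ↔ p b := by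
  by_cases ha : a ≤ i
  · have hb : b ≤ i := by unfold glueRel at hab; omega
    simp [hp a ha, hp b hb]
  · have hb : i < b ∧ r₂ (a - (i + 1)) (b - (i + 1)) := by unfold glueRel at hab; grind
    rw [hpq a (by omega) (h₂.lt _ _ hb.2), hpq b hb.1 (h₂.lt _ _ (h₂.symm _ _ hb.2)), h _ _ hb.2]

theorem iff_of_glueRel_left {i a b : ℕ} {r₁ r₂ : ℕ → ℕ → Prop} {p : ℕ → Prop}
    (hp : ∀ t, i ≤ t → p t) (h0 : p 0) (h : ∀ a b, r₁ a b → (p a ↔ p b))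
    (hab : glueRel i r₁ r₂ a b) : p a ↔ p b := by
  rcases hab with ⟨ha, hb, hab⟩ | ⟨ha, hb⟩ | ⟨ha, hb, hab⟩ | ⟨ha, hb, hab⟩ | ⟨ha, hb, hab⟩
  · exact h _ _ hab
  · simp [ha, hb]
  · simp [hp a ha.ge, ← h _ _ hab, h0]
  · simp [hp b hb.ge, h _ _ hab, h0]
  · simp [hp a ha.le, hp b hb.le]

theorem glueRel_of_krewRel {i j x y : ℕ} {r₁ r₂ : ℕ → ℕ → Prop} (h₁ : IsPartRel i r₁)
    (h₂ : IsPartRel j r₂) (h : krewRel (i + 1 + j) (glueRel i r₁ r₂) x y) :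
    glueRel j (krewRel j r₂) (krewRel i r₁) x y := by
  obtain ⟨hx, hy, h⟩ := h
  have k0 : x ≤ j ↔ y ≤ j := by
    have := h _ _ (glueRel_zero h₁)
    simp only [zero_le, true_iff] at this
    rwa [show i ≤ i + 1 + j - 1 - x ↔ x ≤ j by omega,
      show i ≤ i + 1 + j - 1 - y ↔ y ≤ j by omega] at this
  have kl : ∀ a b, r₁ a b → _ := fun a b hab => h a b
    (Or.inl ⟨h₁.lt _ _ hab, h₁.lt _ _ (h₁.symm _ _ hab), hab⟩)
  have kr : ∀ a b, r₂ a b → a < j ∧ b < j ∧ _ := fun a b hab =>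
    ⟨h₂.lt _ _ hab, h₂.lt _ _ (h₂.symm _ _ hab), h (a + (i + 1)) (b + (i + 1))
    (Or.inr (Or.inr (Or.inr (Or.inr ⟨by omega, by omega, by simpa using hab⟩))))⟩
  have ex : ∀ t, x < j → (t + (i + 1) ≤ i + 1 + j - 1 - x ↔ t ≤ j - 1 - x) := fun t => by omega
  have ey : ∀ t, y < j → (t + (i + 1) ≤ i + 1 + j - 1 - y ↔ t ≤ j - 1 - y) := fun t => by omega
  unfold glueRel krewRel
  rcases lt_trichotomy x j with hxj | hxj | hxj <;> rcases lt_trichotomy y j with hyj | hyj | hyj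
  · left
    refine ⟨hxj, hyj, hxj, hyj, fun a b hab => ?_⟩
    have := (kr a b hab).2.2
    rwa [ex a hxj, ex b hxj, ey a hyj, ey b hyj] at this
  · right; right; right; left
    refine ⟨hxj, hyj, hxj, by omega, fun a b hab => ?_⟩
    obtain ⟨ha, hb, this⟩ := kr a b hab
    rw [ex a hxj, ex b hxj] at this
    have ha' : ¬ a + (i + 1) ≤ i + 1 + j - 1 - y := by omega
    have hb' : ¬ b + (i + 1) ≤ i + 1 + j - 1 - y := by omega
    have ha'' : a ≤ j - 1 - 0 := by omega
    have hb'' : b ≤ j - 1 - 0 := by omega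
    simp only [ha', hb', ha'', hb'', iff_true, iff_false] at this ⊢
    exact not_iff_not.1 this
  · exact absurd k0 (by omega)
  · right; right; left
    refine ⟨hxj, hyj, by omega, hyj, fun a b hab => ?_⟩
    obtain ⟨ha, hb, this⟩ := kr a b hab
    rw [ey a hyj, ey b hyj] at this
    have ha' : ¬ a + (i + 1) ≤ i + 1 + j - 1 - x := by omega
    have hb' : ¬ b + (i + 1) ≤ i + 1 + j - 1 - x := by omega
    have ha'' : a ≤ j - 1 - 0 := by omega
    have hb'' : b ≤ j - 1 - 0 := by omega
    simp only [ha', hb', ha'', hb'', true_iff, false_iff] at this ⊢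
    exact not_iff_not.1 this
  · exact Or.inr (Or.inl ⟨hxj, hyj⟩)
  · exact absurd k0 (by omega)
  · exact absurd k0 (by omega)
  · exact absurd k0 (by omega)
  · right; right; right; right
    refine ⟨hxj, hyj, by omega, by omega, fun a b hab => ?_⟩
    have := kl a b hab
    have hx' : i + 1 + j - 1 - x = i - 1 - (x - (j + 1)) := by omega
    have hy' : i + 1 + j - 1 - y = i - 1 - (y - (j + 1)) := by omega
    rwa [hx', hy'] at this

theorem krewRel_of_glueRel {i j x y : ℕ} {r₁ r₂ : ℕ → ℕ → Prop} (h₂ : IsPartRel j r₂)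
    (h : glueRel j (krewRel j r₂) (krewRel i r₁) x y) :
    krewRel (i + 1 + j) (glueRel i r₁ r₂) x y := by
  have hx : x < i + 1 + j := by unfold glueRel krewRel at h; omega
  have hy : y < i + 1 + j := by unfold glueRel krewRel at h; omega
  refine ⟨hx, hy, fun a b hab => ?_⟩
  rcases h with ⟨hxj, hyj, -, -, h⟩ | ⟨hxj, hyj⟩ | ⟨hxj, hyj, -, -, h⟩ | ⟨hxj, hyj, -, -, h⟩ |
    ⟨hxj, hyj, -, -, h⟩
  · exact iff_of_glueRel_right h₂ (p := fun t => t ≤ i + 1 + j - 1 - x ↔ t ≤ i + 1 + j - 1 - y)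
      (fun t ht => by omega) (fun t ht ht' => by omega) h hab
  · subst hxj hyj; simp
  · exact iff_of_glueRel_right h₂ (p := fun t => t ≤ i + 1 + j - 1 - x ↔ t ≤ i + 1 + j - 1 - y)
      (q := fun t => ¬ (t ≤ j - 1 - 0 ↔ t ≤ j - 1 - y))
      (fun t ht => by omega) (fun t ht ht' => by omega) (fun a b hab => not_congr (h a b hab)) hab
  · exact iff_of_glueRel_right h₂ (p := fun t => t ≤ i + 1 + j - 1 - x ↔ t ≤ i + 1 + j - 1 - y)
      (q := fun t => ¬ (t ≤ j - 1 - x ↔ t ≤ j - 1 - 0))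
      (fun t ht => by omega) (fun t ht ht' => by omega) (fun a b hab => not_congr (h a b hab)) hab
  · have hx' : i + 1 + j - 1 - x = i - 1 - (x - (j + 1)) := by omega
    have hy' : i + 1 + j - 1 - y = i - 1 - (y - (j + 1)) := by omega
    rw [hx', hy']
    exact iff_of_glueRel_left (p := fun t => t ≤ i - 1 - (x - (j + 1)) ↔ t ≤ i - 1 - (y - (j + 1)))
      (fun t ht => by omega) (by simp) h hab

theorem krewRel_glueRel {i j : ℕ} {r₁ r₂ : ℕ → ℕ → Prop} (h₁ : IsPartRel i r₁)
    (h₂ : IsPartRel j r₂) :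
    krewRel (i + 1 + j) (glueRel i r₁ r₂) = glueRel j (krewRel j r₂) (krewRel i r₁) := by
  funext x y
  exact propext ⟨glueRel_of_krewRel h₁ h₂, krewRel_of_glueRel h₂⟩

/-- Sum of a function over all non-crossing partitions of `n` positions, seen as relations. -/
noncomputable def sumNC {M : Type*} [AddCommMonoid M] (n : ℕ) (F : (ℕ → ℕ → Prop) → M) : M :=
  ∑ π ∈ NC n, F π.natRel

theorem glueRel_injective {i i' : ℕ} {r₁ r₂ r₁' r₂' : ℕ → ℕ → Prop} (h₁ : IsPartRel i r₁)
    (h₁' : IsPartRel i' r₁')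
    (h : glueRel i r₁ r₂ = glueRel i' r₁' r₂') : i = i' ∧ r₁ = r₁' ∧ r₂ = r₂' := by
  have hi : i = i' := le_antisymm
    (le_of_glueRel_zero (h ▸ glueRel_zero h₁)) (le_of_glueRel_zero (h ▸ glueRel_zero h₁'))
  subst hi
  refine ⟨rfl, ?_, ?_⟩
  · have aux : ∀ (s₁ s₂ : ℕ → ℕ → Prop), IsPartRel i s₁ →
        ∀ x y, s₁ x y ↔ x < i ∧ y < i ∧ glueRel i s₁ s₂ x y := by
      intro s₁ s₂ hs x y
      have h1 := hs.lt x y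
      have h2 := hs.lt y x
      have h3 := hs.symm x y
      unfold glueRel
      grind
    funext x y
    rw [eq_iff_iff, aux r₁ r₂ h₁, aux r₁' r₂' h₁', h]
  · have aux : ∀ (s₁ s₂ : ℕ → ℕ → Prop),
        ∀ x y, s₂ x y ↔ glueRel i s₁ s₂ (x + (i + 1)) (y + (i + 1)) := by
      intro s₁ s₂ x y
      unfold glueRel
      grind
    funext x y
    rw [eq_iff_iff, aux r₁ r₂, aux r₁' r₂', h]

theorem exists_eq_glueRel {n : ℕ} {r : ℕ → ℕ → Prop} (h : IsPartRel (n + 1) r)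
    (hn : NonCrossingRel r) : ∃ i j r₁ r₂, i + j = n ∧ IsPartRel i r₁ ∧ IsPartRel j r₂ ∧
      NonCrossingRel r₁ ∧ NonCrossingRel r₂ ∧ glueRel i r₁ r₂ = r := by
  classical
  have h0 : r 0 0 := h.refl 0 (by omega)
  set i := Nat.findGreatest (r 0) n with hi
  have hi0 : r 0 i := Nat.findGreatest_spec (P := r 0) (Nat.zero_le n) h0
  have hin : i ≤ n := Nat.findGreatest_le n
  have hmax : ∀ y, r 0 y → y ≤ i := fun y hy =>
    Nat.le_findGreatest (by have := h.lt _ _ (h.symm _ _ hy); omega) hy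
  have hs := h.symm
  have ht := h.trans
  have hr := h.refl
  have hlt := h.lt
  refine ⟨i, n - i, fun x y => x < i ∧ y < i ∧ r x y,
    fun x y => r (x + (i + 1)) (y + (i + 1)), by omega, ?_, ?_, ?_, ?_, ?_⟩
  · exact ⟨fun x y h => h.1, fun x hx => ⟨hx, hx, hr x (by omega)⟩,
      fun x y ⟨h1, h2, h3⟩ => ⟨h2, h1, hs _ _ h3⟩,
      fun x y z ⟨h1, h2, h3⟩ ⟨_, h2', h3'⟩ => ⟨h1, h2', ht _ _ _ h3 h3'⟩⟩
  · exact ⟨fun x y h => by have := hlt _ _ h; omega, fun x hx => hr _ (by omega),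
      fun x y h => hs _ _ h, fun x y z h1 h2 => ht _ _ _ h1 h2⟩
  · rintro a b c d hab hbc hcd ⟨h1, h2, h3⟩ ⟨h4, h5, h6⟩
    exact ⟨h1, h4, hn a b c d hab hbc hcd h3 h6⟩
  · intro a b c d hab hbc hcd h1 h2
    exact hn _ _ _ _ (by omega) (by omega) (by omega) h1 h2
  · have cross : ∀ x y, r x y → x ≤ i → i < y → False := by
      intro x y hxy hx hy
      have h0y : r 0 y := by
        rcases Nat.eq_zero_or_pos x with rfl | hx0
        · exact hxy
        · rcases hx.lt_or_eq with hx | rfl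
          · exact ht _ _ _ (hn 0 x i y hx0 hx hy hi0 hxy) hxy
          · exact ht _ _ _ hi0 hxy
      exact absurd (hmax y h0y) (by omega)
    funext x y
    have c1 := cross x y
    have c2 := cross y x
    have sxy := hs x y
    have e : ∀ t, i < t → t - (i + 1) + (i + 1) = t := fun t ht => by omega
    apply propext
    unfold glueRel
    constructor
    · rintro (⟨-, -, -, -, h⟩ | ⟨h1, h2⟩ | ⟨h1, -, -, -, h2⟩ | ⟨-, h1, -, -, h2⟩ | ⟨h1, h2, h3⟩)
      · exact h
      · rw [h1, h2]; exact hr _ (by omega)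
      · rw [h1]; exact ht _ _ _ (hs _ _ hi0) h2
      · rw [h1]; exact ht _ _ _ h2 hi0
      · rwa [e x h1, e y h2] at h3
    · intro hxy
      rcases lt_trichotomy x i with hx | hx | hx <;> rcases lt_trichotomy y i with hy | hy | hy
      · exact Or.inl ⟨hx, hy, hx, hy, hxy⟩
      · exact Or.inr (Or.inr (Or.inr (Or.inl
          ⟨hx, hy, hx, by omega, ht _ _ _ (hy ▸ hxy) (hs _ _ hi0)⟩)))
      · exact (c1 hxy hx.le hy).elim
      · exact Or.inr (Or.inr (Or.inl ⟨hx, hy, by omega, hy, ht _ _ _ hi0 (hx ▸ hxy)⟩))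
      · exact Or.inr (Or.inl ⟨hx, hy⟩)
      · exact (c1 hxy hx.le hy).elim
      · exact (c2 (sxy hxy) hy.le hx).elim
      · exact (c2 (sxy hxy) hy.le hx).elim
      · refine Or.inr (Or.inr (Or.inr (Or.inr ⟨hx, hy, ?_⟩)))
        simpa only [e x hx, e y hy] using hxy

/-- Decomposition of the non-crossing partitions at the last element of the first block. -/
theorem sumNC_succ {M : Type*} [AddCommMonoid M] (n : ℕ) (F : (ℕ → ℕ → Prop) → M) :
    sumNC (n + 1) F = ∑ p ∈ antidiagonal n,
      sumNC p.1 fun r₁ => sumNC p.2 fun r₂ => F (glueRel p.1 r₁ r₂) := by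
  have ex : ∀ x : (Σ p : ℕ × ℕ, SetPartition p.1 × SetPartition p.2), x.1 ∈ antidiagonal n →
      ∃ P : SetPartition (n + 1), P.natRel = glueRel x.1.1 x.2.1.natRel x.2.2.natRel := by
    intro x hx
    have hn : n + 1 = x.1.1 + 1 + x.1.2 := by have := mem_antidiagonal.1 hx; omega
    rw [hn]
    exact exists_natRel_eq ((isPartRel_natRel _).glue (isPartRel_natRel _))
  have h1 : ∀ p ∈ antidiagonal n, (sumNC p.1 fun r₁ => sumNC p.2 fun r₂ => F (glueRel p.1 r₁ r₂)) =
      ∑ x ∈ NC p.1 ×ˢ NC p.2, F (glueRel p.1 x.1.natRel x.2.natRel) := by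
    intro p _
    simp only [sumNC, sum_product]
  rw [sum_congr rfl h1, sum_sigma', sumNC]
  symm
  refine sum_bij (fun x hx => (ex x (mem_sigma.1 hx).1).choose) ?_ ?_ ?_ ?_
  · intro x hx
    have hx' := mem_product.1 (mem_sigma.1 hx).2
    rw [mem_NC_iff, (ex x (mem_sigma.1 hx).1).choose_spec]
    exact NonCrossingRel.glue (isPartRel_natRel _) ((mem_NC_iff _).1 hx'.1)
      ((mem_NC_iff _).1 hx'.2)
  · intro x hx y hy hxy
    have hs := (ex x (mem_sigma.1 hx).1).choose_spec
    rw [hxy, (ex y (mem_sigma.1 hy).1).choose_spec] at hs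
    obtain ⟨e1, e2, e3⟩ := glueRel_injective (isPartRel_natRel _) (isPartRel_natRel _) hs
    have hx1 := mem_antidiagonal.1 (mem_sigma.1 hx).1
    have hy1 := mem_antidiagonal.1 (mem_sigma.1 hy).1
    obtain ⟨⟨i, j⟩, P, Q⟩ := x
    obtain ⟨⟨i', j'⟩, P', Q'⟩ := y
    simp only at e1 e2 e3 hx1 hy1
    subst e1
    obtain rfl : j = j' := by omega
    rw [natRel_injective e2, natRel_injective e3]
  · intro P hP
    obtain ⟨i, j, r₁, r₂, hij, h₁, h₂, hn₁, hn₂, hr⟩ :=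
      exists_eq_glueRel (isPartRel_natRel P) ((mem_NC_iff P).1 hP)
    obtain ⟨P₁, rfl⟩ := exists_natRel_eq h₁
    obtain ⟨P₂, rfl⟩ := exists_natRel_eq h₂
    have hmem : (⟨(i, j), (P₁, P₂)⟩ : (Σ p : ℕ × ℕ, SetPartition p.1 × SetPartition p.2)) ∈
        (antidiagonal n).sigma fun p => NC p.1 ×ˢ NC p.2 := by
      rw [mem_sigma, mem_product, mem_NC_iff, mem_NC_iff]
      exact ⟨mem_antidiagonal.2 hij, hn₁, hn₂⟩
    refine ⟨_, hmem, natRel_injective ?_⟩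
    rw [(ex _ (mem_sigma.1 hmem).1).choose_spec]
    exact hr
  · intro x hx
    rw [(ex x (mem_sigma.1 hx).1).choose_spec]

open Classical in
/-- The size of the class of `x`. -/
noncomputable def classSize (n : ℕ) (r : ℕ → ℕ → Prop) (x : ℕ) : ℕ :=
  #{y ∈ range n | r x y}

open Classical in
/-- The factor of `x` in the product of the weights of the classes: the weight of its class if `x`
is the least element of it, and `1` otherwise. -/
noncomputable def classWeight {R : Type*} [CommRing R] (n : ℕ) (c : ℕ → R) (r : ℕ → ℕ → Prop)
    (x : ℕ) : R :=
  if ∀ y, r x y → x ≤ y then c (classSize n r x) else 1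

/-- The product of the weights of the classes, where the class of `0` has the weight `α` of its
size, and the other classes the weight `c`. -/
noncomputable def relWeight {R : Type*} [CommRing R] (n : ℕ) (α c : ℕ → R)
    (r : ℕ → ℕ → Prop) : R :=
  α (classSize n r 0) * ∏ x ∈ Ico 1 n, classWeight n c r x

theorem relWeight_self {R : Type*} [CommRing R] (n : ℕ) {c : ℕ → R} (hc : c 0 = 1)
    (r : ℕ → ℕ → Prop) : relWeight n c c r = ∏ x ∈ range n, classWeight n c r x := by
  rcases n with _ | n
  · simp [relWeight, classSize, hc]
  · rw [range_eq_Ico, prod_eq_prod_Ico_succ_bot (by omega : 0 < n + 1)]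
    simp [relWeight, classWeight]

theorem relWeight_glueRel {R : Type*} [CommRing R] {i j : ℕ} {r₁ r₂ : ℕ → ℕ → Prop}
    (h₁ : IsPartRel i r₁) (h₂ : IsPartRel j r₂) (α : ℕ → R) {c : ℕ → R} (hc : c 0 = 1) :
    relWeight (i + 1 + j) α c (glueRel i r₁ r₂) =
      relWeight i (fun k => α (k + 1)) c r₁ * relWeight j c c r₂ := by
  classical
  have hsize0 : classSize (i + 1 + j) (glueRel i r₁ r₂) 0 = classSize i r₁ 0 + 1 := by
    have : (range (i + 1 + j)).filter (glueRel i r₁ r₂ 0) =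
        insert i ((range i).filter (r₁ 0)) := by
      ext y
      have := h₁.refl 0
      simp only [mem_filter, mem_range, mem_insert]
      unfold glueRel
      grind
    rw [classSize, this, card_insert_of_notMem (by simp), classSize]
  have hleft : ∀ x ∈ Ico 1 i, classWeight (i + 1 + j) c (glueRel i r₁ r₂) x =
      classWeight i c r₁ x := by
    intro x hx
    have hx' := mem_Ico.1 hx
    unfold classWeight
    by_cases h0 : r₁ x 0
    · have h1 : glueRel i r₁ r₂ x 0 := by unfold glueRel; grind
      rw [if_neg, if_neg]
      · intro h; have := h 0 h0; omega
      · intro h; have := h 0 h1; omega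
    · have h2 : ∀ y, glueRel i r₁ r₂ x y ↔ r₁ x y := by
        intro y
        have := h₁.lt y x
        have := h₁.symm x y
        unfold glueRel
        grind
      have h3 : classSize (i + 1 + j) (glueRel i r₁ r₂) x = classSize i r₁ x := by
        unfold classSize
        congr 1
        ext y
        have := h₁.lt y x
        have := h₁.symm x y
        simp only [mem_filter, mem_range, h2]
        grind
      simp only [h2, h3]
  have hright : ∀ x, classWeight (i + 1 + j) c (glueRel i r₁ r₂) (i + 1 + x) =
      classWeight j c r₂ x := by
    intro x
    have h2 : ∀ y, glueRel i r₁ r₂ (i + 1 + x) y ↔ i < y ∧ r₂ x (y - (i + 1)) := by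
      intro y
      unfold glueRel
      grind
    have h3 : classSize (i + 1 + j) (glueRel i r₁ r₂) (i + 1 + x) = classSize j r₂ x := by
      unfold classSize
      symm
      refine card_bij (fun y _ => y + (i + 1)) ?_ ?_ ?_
      · intro y hy
        simp only [mem_filter, mem_range, h2] at hy ⊢
        exact ⟨by omega, by omega, by simpa using hy.2⟩
      · intro y _ z _ h
        omega
      · intro y hy
        simp only [mem_filter, mem_range, h2] at hy
        exact ⟨y - (i + 1), by simp only [mem_filter, mem_range]; exact ⟨by omega, hy.2.2⟩,
          by omega⟩
    unfold classWeight
    rw [h3]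
    refine if_congr ?_ rfl rfl
    simp only [h2]
    constructor
    · intro h y hy
      have := h (y + (i + 1)) ⟨by omega, by simpa using hy⟩
      omega
    · rintro h y ⟨hy, hr⟩
      have := h _ hr
      omega
  have hmid : ∏ x ∈ Ico 1 (i + 1), classWeight (i + 1 + j) c (glueRel i r₁ r₂) x =
      ∏ x ∈ Ico 1 i, classWeight i c r₁ x := by
    rcases Nat.eq_zero_or_pos i with rfl | hi
    · simp
    · rw [prod_Ico_succ_top hi, prod_congr rfl hleft, classWeight, if_neg, mul_one]
      intro h
      have := h 0 ((h₁.glue h₂).symm _ _ (glueRel_zero h₁))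
      omega
  rw [relWeight, ← prod_Ico_consecutive _ (by omega : 1 ≤ i + 1) (by omega : i + 1 ≤ i + 1 + j),
    hmid, prod_Ico_eq_prod_range _ (i + 1), hsize0, relWeight_self j hc, relWeight,
    show i + 1 + j - (i + 1) = j by omega, prod_congr rfl fun x _ => hright x, mul_assoc]

theorem prod_parts_eq_prod_classWeight {R : Type*} [CommRing R] {n : ℕ} (P : SetPartition n)
    (o : Fin n ≃ Fin n) (c : ℕ → R) {r : ℕ → ℕ → Prop}
    (hr : ∀ x y, r x y ↔ ∃ (hx : x < n) (hy : y < n), P.Rel (o ⟨x, hx⟩) (o ⟨y, hy⟩)) :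
    ∏ V ∈ P.parts, c V.card = ∏ x ∈ range n, classWeight n c r x := by
  classical
  have hrel : ∀ x y : Fin n, r x y ↔ P.Rel (o x) (o y) := fun x y => by
    rw [hr]; simp
  have hsize : ∀ x : Fin n, classSize n r x = (P.part (o x)).card := by
    intro x
    unfold classSize
    symm
    refine card_bij (fun y _ => (o.symm y : ℕ)) ?_ ?_ ?_
    · intro y hy
      have h1 := (P.mem_part_iff_part_eq_part (mem_univ _) (mem_univ _)).1 hy
      simp only [mem_filter, mem_range, hrel, SetPartition.Rel, Equiv.apply_symm_apply]
      exact ⟨(o.symm y).2, h1.symm⟩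
    · intro y _ z _ h
      exact o.symm.injective (Fin.ext h)
    · intro y hy
      simp only [mem_filter, mem_range] at hy
      refine ⟨o ⟨y, hy.1⟩, ?_, by simp⟩
      exact (P.mem_part_iff_part_eq_part (mem_univ _) (mem_univ _)).2
        ((hrel x ⟨y, hy.1⟩).1 hy.2).symm
  have hlead : ∀ x : Fin n, (∀ y, r x y → (x : ℕ) ≤ y) ↔ ∀ y : Fin n, P.Rel (o x) (o y) → x ≤ y := by
    intro x
    constructor
    · intro h y hy
      exact h y ((hrel x y).2 hy)
    · intro h y hy
      obtain ⟨-, hy', -⟩ := (hr _ _).1 hy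
      exact h ⟨y, hy'⟩ ((hrel x ⟨y, hy'⟩).1 hy)
  rw [← Fin.prod_univ_eq_prod_range]
  simp only [classWeight, hsize, hlead]
  rw [← prod_filter]
  symm
  refine prod_bij (fun x _ => P.part (o x)) ?_ ?_ ?_ ?_
  · intro x _
    exact P.part_mem.2 (mem_univ _)
  · intro x hx y hy h
    exact le_antisymm ((mem_filter.1 hx).2 y h) ((mem_filter.1 hy).2 x h.symm)
  · intro V hV
    have hne : (V.image o.symm).Nonempty := (P.nonempty_of_mem_parts hV).image _
    obtain ⟨v, hv, hv'⟩ := mem_image.1 (min'_mem _ hne)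
    refine ⟨(V.image o.symm).min' hne, ?_, ?_⟩
    · simp only [mem_filter, mem_univ, true_and]
      intro y hy
      refine min'_le _ _ (mem_image.2 ⟨o y, ?_, by simp⟩)
      rw [← hv', Equiv.apply_symm_apply, SetPartition.Rel, P.part_eq_of_mem hV hv] at hy
      rw [hy]
      exact P.mem_part_self.2 (mem_univ _)
    · rw [← hv', Equiv.apply_symm_apply, P.part_eq_of_mem hV hv]
  · intro x _
    rfl

theorem coeffAlong_eq_prod {R : Type*} [CommRing R] {n : ℕ} (P : SetPartition n) (f : R⟦X⟧) :
    coeffAlong P f = ∏ V ∈ P.parts, coeff V.card (1 + f) := by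
  refine prod_congr rfl fun V hV => ?_
  have : V.card ≠ 0 := (card_pos.2 (P.nonempty_of_mem_parts hV)).ne'
  simp [coeff_one, this]

theorem coeffAlong_eq_relWeight {R : Type*} [CommRing R] {n : ℕ} (P : SetPartition n) {f : R⟦X⟧}
    (hf : constantCoeff f = 0) :
    coeffAlong P f =
      relWeight n (fun k => coeff k (1 + f)) (fun k => coeff k (1 + f)) P.natRel := by
  rw [coeffAlong_eq_prod, relWeight_self n (by simp [hf])]
  exact prod_parts_eq_prod_classWeight P (Equiv.refl _) (fun k => coeff k (1 + f)) fun x y => Iff.rfl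

theorem coeffAlong_kreweras_eq_relWeight {R : Type*} [CommRing R] {n : ℕ} (P : SetPartition n)
    {f : R⟦X⟧} (hf : constantCoeff f = 0) :
    coeffAlong P.kreweras f =
      relWeight n (fun k => coeff k (1 + f)) (fun k => coeff k (1 + f)) (krewRel n P.natRel) := by
  rw [coeffAlong_eq_prod, relWeight_self n (by simp [hf])]
  refine prod_parts_eq_prod_classWeight P.kreweras Fin.revPerm (fun k => coeff k (1 + f))
    fun x y => ?_
  rw [natRel_kreweras]
  constructor
  · rintro ⟨hx, hy, _, _, h⟩
    refine ⟨hx, hy, ?_⟩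
    convert h using 1 <;> (ext; simp [Fin.rev]; omega)
  · rintro ⟨hx, hy, h⟩
    refine ⟨hx, hy, by omega, by omega, ?_⟩
    convert h using 1 <;> (ext; simp [Fin.rev]; omega)

theorem isPartRel_krewRel {n : ℕ} (r : ℕ → ℕ → Prop) : IsPartRel n (krewRel n r) where
  lt := fun _ _ h => h.1
  refl := fun _ h => ⟨h, h, fun _ _ _ => by simp⟩
  symm := fun _ _ ⟨h, h', e⟩ => ⟨h', h, fun a b hab => by have := e a b hab; tauto⟩
  trans := fun _ _ _ ⟨h, _, e⟩ ⟨_, h', e'⟩ =>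
    ⟨h, h', fun a b hab => by have := e a b hab; have := e' a b hab; tauto⟩

/-- The series of the sums over the non-crossing partitions, where the first block has the weight
`α`, the other blocks have the weight `a`, the last block of the Kreweras complement has the
weight `β`, and the other blocks of the Kreweras complement have the weight `b`. -/
noncomputable def boxSeries {R : Type*} [CommRing R] (a b α β : ℕ → R) : R⟦X⟧ :=
  PowerSeries.mk fun n =>
    sumNC n fun r => relWeight n α a r * relWeight n β b (krewRel n r)

theorem boxSeries_eq {R : Type*} [CommRing R] {a b : ℕ → R} (ha : a 0 = 1) (hb : b 0 = 1)
    (α β : ℕ → R) :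
    boxSeries a b α β = C (α 0 * β 0) +
      X * (boxSeries a b (fun k => α (k + 1)) b * boxSeries a b a fun k => β (k + 1)) := by
  ext n
  rcases n with _ | n
  · have hNC : (NC 0).card = 1 := by decide
    simp [boxSeries, sumNC, relWeight, classSize, hNC]
  · have hC : coeff (n + 1) (C (α 0 * β 0)) = 0 := by rw [coeff_C, if_neg (by omega)]
    rw [map_add, hC, zero_add, coeff_succ_X_mul, coeff_mul, boxSeries, coeff_mk, sumNC_succ]
    refine sum_congr rfl fun p hp => ?_
    obtain ⟨i, j⟩ := p
    have hn : n + 1 = i + 1 + j := by have := mem_antidiagonal.1 hp; simp only at this; omega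
    have hn' : n + 1 = j + 1 + i := by omega
    simp only [boxSeries, coeff_mk]
    rw [sumNC, sumNC, sum_mul]
    refine sum_congr rfl fun π _ => ?_
    rw [sumNC, sumNC, mul_sum]
    refine sum_congr rfl fun ρ _ => ?_
    have h1 := isPartRel_natRel π
    have h2 := isPartRel_natRel ρ
    have e1 : relWeight (n + 1) α a (glueRel i π.natRel ρ.natRel) =
        relWeight i (fun k => α (k + 1)) a π.natRel * relWeight j a a ρ.natRel := by
      rw [hn]; exact relWeight_glueRel h1 h2 α ha
    have e2 : relWeight (n + 1) β b (krewRel (n + 1) (glueRel i π.natRel ρ.natRel)) =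
        relWeight j (fun k => β (k + 1)) b (krewRel j ρ.natRel) *
          relWeight i b b (krewRel i π.natRel) := by
      rw [hn, krewRel_glueRel h1 h2, ← hn, hn']
      exact relWeight_glueRel (isPartRel_krewRel _) (isPartRel_krewRel _) β hb
    rw [e1, e2]
    ring

theorem boxedConv_eq_boxSeries {R : Type*} [CommRing R] {f g : R⟦X⟧} (hf : constantCoeff f = 0)
    (hg : constantCoeff g = 0) :
    1 + boxedConv f g = boxSeries (fun k => coeff k (1 + f)) (fun k => coeff k (1 + g))
      (fun k => coeff k (1 + f)) (fun k => coeff k (1 + g)) := by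
  ext n
  rcases n with _ | n
  · rw [boxSeries_eq (by simp [hf]) (by simp [hg])]
    simp [boxedConv, hf, hg]
  · rw [boxSeries, coeff_mk, map_add, coeff_one, if_neg (by omega), zero_add, boxedConv, coeff_mk,
      if_neg (by omega), sumNC]
    refine sum_congr rfl fun π _ => ?_
    rw [coeffAlong_eq_relWeight π hf, coeffAlong_kreweras_eq_relWeight π hg]

/-- A family of series indexed by sequences, with `D α = α₀ + p D α⁺`, is substitution of `p`. -/
theorem eq_subst_of_shift {R : Type*} [CommRing R] {p : R⟦X⟧} (hp : constantCoeff p = 0)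
    {D : (ℕ → R) → R⟦X⟧} (hD : ∀ α, D α = C (α 0) + p * D fun k => α (k + 1)) (α : ℕ → R) :
    D α = (PowerSeries.mk α).subst p := by
  have hs : HasSubst p := HasSubst.of_constantCoeff_zero' hp
  have hsub : ∀ α : ℕ → R, (PowerSeries.mk α).subst p =
      C (α 0) + p * (PowerSeries.mk fun k => α (k + 1)).subst p := by
    intro α
    have : PowerSeries.mk α = C (α 0) + X * PowerSeries.mk fun k => α (k + 1) := by
      ext n
      rcases n with _ | n
      · simp
      · simp [coeff_succ_X_mul]
    conv_lhs => rw [this]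
    rw [subst_add hs, subst_mul hs, subst_X hs, subst_C]
    rfl
  have key : ∀ n, ∀ α, coeff n (D α - (PowerSeries.mk α).subst p) = 0 := by
    intro n
    induction n using Nat.strong_induction_on with
    | _ n ih =>
      intro α
      have : D α - (PowerSeries.mk α).subst p =
          p * ((D fun k => α (k + 1)) - (PowerSeries.mk fun k => α (k + 1)).subst p) := by
        rw [hD α, hsub α]; ring
      rw [this, coeff_mul]
      refine sum_eq_zero fun q hq => ?_
      have hq' := mem_antidiagonal.1 hq
      rcases Nat.eq_zero_or_pos q.1 with h | h
      · rw [h, coeff_zero_eq_constantCoeff_apply, hp, zero_mul]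
      · rw [ih q.2 (by omega), mul_zero]
  exact sub_eq_zero.1 (ext fun n => by rw [key n α, map_zero])

/-- The functional equations of boxed convolution. -/
theorem exists_boxedConv_eq_subst {R : Type*} [CommRing R] {f g : R⟦X⟧} (hf : constantCoeff f = 0)
    (hg : constantCoeff g = 0) : ∃ p q : R⟦X⟧, constantCoeff p = 0 ∧ constantCoeff q = 0 ∧
      boxedConv f g = f.subst p ∧ boxedConv f g = g.subst q ∧ p * q = X * boxedConv f g := by
  set a : ℕ → R := fun k => coeff k (1 + f) with ha
  set b : ℕ → R := fun k => coeff k (1 + g) with hb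
  have ha0 : a 0 = 1 := by simp [ha, hf]
  have hb0 : b 0 = 1 := by simp [hb, hg]
  have hH := boxedConv_eq_boxSeries hf hg
  have h1 := eq_subst_of_shift (p := X * boxSeries a b a fun k => b (k + 1)) (by simp)
    (D := fun α => boxSeries a b α b)
    (fun α => by rw [boxSeries_eq ha0 hb0, hb0, mul_one]; ring) a
  have h2 := eq_subst_of_shift (p := X * boxSeries a b (fun k => a (k + 1)) b) (by simp)
    (D := fun β => boxSeries a b a β)
    (fun β => by rw [boxSeries_eq ha0 hb0, ha0, one_mul]; ring) b
  have h3 := boxSeries_eq ha0 hb0 a b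
  have hmk : ∀ f : R⟦X⟧, (PowerSeries.mk fun k => coeff k (1 + f)) = 1 + f := fun f => by
    ext n; simp
  have hone : ∀ {u p : R⟦X⟧}, constantCoeff p = 0 → (1 + u).subst p = 1 + u.subst p :=
    fun hp => by
      have hs := HasSubst.of_constantCoeff_zero' hp
      rw [← coe_substAlgHom hs, map_add, map_one]
  have hp : constantCoeff (X * boxSeries a b a fun k => b (k + 1)) = 0 := by simp
  have hq : constantCoeff (X * boxSeries a b (fun k => a (k + 1)) b) = 0 := by simp
  rw [hmk, hone hp, ← hH, add_right_inj] at h1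
  rw [hmk, hone hq, ← hH, add_right_inj] at h2
  rw [ha0, hb0, mul_one, map_one, ← hH, add_right_inj] at h3
  refine ⟨_, _, hp, hq, h1, h2, ?_⟩
  rw [h3]
  ring

namespace GOnePlus

theorem constantCoeff_eq_zero {R : Type*} [CommRing R] (f : GOnePlus R) :
    constantCoeff f.1 = 0 := by
  rw [← coeff_zero_eq_constantCoeff_apply]; exact f.2.1

theorem hasSubst {R : Type*} [CommRing R] (f : GOnePlus R) : HasSubst f.1 :=
  HasSubst.of_constantCoeff_zero' f.constantCoeff_eq_zero

theorem ext_coords {R : Type*} [CommRing R] {f g : GOnePlus R} (h : f.coords = g.coords) :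
    f = g := by
  apply Subtype.ext
  ext n
  rcases n with _ | _ | n
  · rw [f.2.1, g.2.1]
  · rw [f.2.2, g.2.2]
  · exact congrFun h n

theorem isUnit_coeff_one {R : Type*} [CommRing R] (f : GOnePlus R) : IsUnit (coeff 1 f.1) := by
  rw [f.2.2]; exact isUnit_one

/-- The inverse with respect to composition. -/
noncomputable def compInv {R : Type*} [CommRing R] (f : GOnePlus R) : GOnePlus R :=
  ⟨f.1.substInvOfIsUnit f.isUnit_coeff_one, by simp, by
    rw [coeff_one_substInvOfIsUnit, Units.val_eq_one, inv_eq_one]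
    exact Units.ext f.2.2⟩

theorem compInv_subst {R : Type*} [CommRing R] (f : GOnePlus R) : f.compInv.1.subst f.1 = X :=
  subst_substInvOfIsUnit_left _ f.constantCoeff_eq_zero _

theorem subst_compInv {R : Type*} [CommRing R] (f : GOnePlus R) : f.1.subst f.compInv.1 = X :=
  subst_substInvOfIsUnit_right _ f.constantCoeff_eq_zero _

theorem eq_compInv {R : Type*} [CommRing R] {f g : GOnePlus R} (h : f.1.subst g.1 = X) :
    g = f.compInv := by
  apply Subtype.ext
  calc g.1 = (X : R⟦X⟧).subst g.1 := (subst_X g.hasSubst).symm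
    _ = f.compInv.1.subst (f.1.subst g.1) := by
      rw [← compInv_subst f, subst_comp_subst_apply f.hasSubst g.hasSubst]
    _ = f.compInv.1 := by rw [h, X_subst]

theorem compInv_compInv {R : Type*} [CommRing R] (f : GOnePlus R) : f.compInv.compInv = f :=
  (eq_compInv f.compInv_subst).symm

theorem compInv_map {R : Type u} {S : Type v} [CommRing R] [CommRing S] (φ : R →+* S)
    (f : GOnePlus R) : (map φ f).compInv = map φ f.compInv := by
  symm
  apply eq_compInv
  have := PowerSeries.map_subst (f.compInv.hasSubst) (h := φ) f.1
  rw [subst_compInv] at this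
  exact this.symm.trans (PowerSeries.map_X φ)

/-- The `S`-transform `f⁻¹(z) / z`, where `f⁻¹` is the inverse of `f` for composition. -/
noncomputable def sTransform {R : Type*} [CommRing R] (f : GOnePlus R) : R⟦X⟧ :=
  PowerSeries.mk fun n => coeff (n + 1) f.compInv.1

theorem X_mul_sTransform {R : Type*} [CommRing R] (f : GOnePlus R) :
    X * f.sTransform = f.compInv.1 := by
  ext n
  rcases n with _ | n
  · rw [f.compInv.2.1]; simp
  · simp [sTransform, coeff_succ_X_mul]

theorem constantCoeff_sTransform {R : Type*} [CommRing R] (f : GOnePlus R) :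
    constantCoeff f.sTransform = 1 := by
  rw [← coeff_zero_eq_constantCoeff_apply, sTransform, coeff_mk]
  exact f.compInv.2.2

theorem sTransform_injective {R : Type*} [CommRing R] :
    Function.Injective (sTransform (R := R)) := by
  intro f g h
  rw [← compInv_compInv f, ← compInv_compInv g]
  congr 1
  apply Subtype.ext
  rw [← X_mul_sTransform, ← X_mul_sTransform, h]

theorem exists_sTransform_eq {R : Type*} [CommRing R] {s : R⟦X⟧} (hs : constantCoeff s = 1) :
    ∃ f : GOnePlus R, f.sTransform = s := by
  let g : GOnePlus R := ⟨X * s, by simp, by simp [coeff_succ_X_mul, hs]⟩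
  refine ⟨g.compInv, ?_⟩
  apply X_mul_cancel
  rw [X_mul_sTransform, compInv_compInv g]

theorem sTransform_map {R : Type u} {S : Type v} [CommRing R] [CommRing S] (φ : R →+* S)
    (f : GOnePlus R) : (map φ f).sTransform = PowerSeries.map φ f.sTransform := by
  ext n
  rw [sTransform, compInv_map]
  simp [sTransform, map]

/-- The `S`-transform takes boxed convolution to the product of series. -/
theorem sTransform_mul {R : Type*} [CommRing R] (f g : GOnePlus R) :
    (f * g).sTransform = f.sTransform * g.sTransform := by
  obtain ⟨p, q, hp, hq, h1, h2, h3⟩ :=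
    exists_boxedConv_eq_subst f.constantCoeff_eq_zero g.constantCoeff_eq_zero
  have hmul : (f * g).1 = boxedConv f.1 g.1 := rfl
  rw [← hmul] at h1 h2 h3
  have aux : ∀ (f : GOnePlus R) {h p : R⟦X⟧}, constantCoeff p = 0 → h = f.1.subst p →
      f.compInv.1.subst h = p := by
    intro f h p hp hfp
    have hs := HasSubst.of_constantCoeff_zero' hp
    rw [hfp, ← subst_comp_subst_apply f.hasSubst hs, compInv_subst, subst_X hs]
  have hh := (f * g).hasSubst
  have hi := (f * g).compInv.hasSubst
  have key : (f.compInv.1 * g.compInv.1).subst (f * g).1 = X * (f * g).1 := by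
    rw [subst_mul hh, aux f hp h1, aux g hq h2, h3]
  have key2 : f.compInv.1 * g.compInv.1 = (f * g).compInv.1 * X := by
    calc f.compInv.1 * g.compInv.1
        = (f.compInv.1 * g.compInv.1).subst ((f * g).1.subst (f * g).compInv.1) := by
          rw [subst_compInv, X_subst]
      _ = (X * (f * g).1).subst (f * g).compInv.1 := by
          rw [← subst_comp_subst_apply hh hi, key]
      _ = _ := by rw [subst_mul hi, subst_X hi, subst_compInv]
  rw [← X_mul_sTransform, ← X_mul_sTransform, ← X_mul_sTransform] at key2
  apply X_mul_cancel
  apply X_mul_cancel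
  linear_combination -key2

/-- The series `z`. -/
noncomputable def identity (R : Type*) [CommRing R] : GOnePlus R := ⟨X, by simp, by simp⟩

theorem sTransform_identity (R : Type*) [CommRing R] : (identity R).sTransform = 1 := by
  apply X_mul_cancel
  rw [X_mul_sTransform, ← eq_compInv (f := identity R) (g := identity R) (X_subst _), mul_one]
  rfl

end GOnePlus

/-- The logarithmic derivative of a series with constant coefficient `1`. -/
noncomputable def PowerSeries.logDerivative {R : Type*} [CommRing R] (s : R⟦X⟧) : R⟦X⟧ :=
  d⁄dX R s * s.invOfUnit 1

theorem PowerSeries.logDerivative_unique {R : Type*} [CommRing R] {s L : R⟦X⟧}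
    (hs : constantCoeff s = 1) (h : d⁄dX R s = L * s) : s.logDerivative = L := by
  rw [logDerivative, h, mul_assoc, mul_invOfUnit _ _ (by simpa using hs), mul_one]

theorem PowerSeries.derivative_eq_logDerivative_mul {R : Type*} [CommRing R] {s : R⟦X⟧}
    (hs : constantCoeff s = 1) : d⁄dX R s = s.logDerivative * s := by
  rw [logDerivative, mul_assoc, invOfUnit_mul _ _ (by simpa using hs), mul_one]

theorem PowerSeries.logDerivative_mul {R : Type*} [CommRing R] {s t : R⟦X⟧}
    (hs : constantCoeff s = 1) (ht : constantCoeff t = 1) :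
    (s * t).logDerivative = s.logDerivative + t.logDerivative := by
  apply logDerivative_unique (by simp [hs, ht])
  rw [Derivation.leibniz, derivative_eq_logDerivative_mul hs, derivative_eq_logDerivative_mul ht,
    smul_eq_mul, smul_eq_mul]
  ring

theorem PowerSeries.logDerivative_map {R : Type u} {S : Type v} [CommRing R] [CommRing S]
    (φ : R →+* S) {s : R⟦X⟧} (hs : constantCoeff s = 1) :
    (PowerSeries.map φ s).logDerivative = PowerSeries.map φ s.logDerivative := by
  have hd : d⁄dX S (PowerSeries.map φ s) = PowerSeries.map φ (d⁄dX R s) := by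
    ext n
    simp [coeff_derivative]
  apply logDerivative_unique
  · rw [← coeff_zero_eq_constantCoeff_apply, coeff_map, coeff_zero_eq_constantCoeff_apply, hs,
      map_one]
  · rw [hd, derivative_eq_logDerivative_mul hs, map_mul]

theorem PowerSeries.eq_of_logDerivative_eq {R : Type*} [CommRing R] [Algebra ℚ R] {s t : R⟦X⟧}
    (hs : constantCoeff s = 1) (ht : constantCoeff t = 1)
    (h : s.logDerivative = t.logDerivative) : s = t := by
  have hs' := derivative_eq_logDerivative_mul hs
  have ht' := derivative_eq_logDerivative_mul ht
  rw [h] at hs'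
  ext n
  induction n using Nat.strong_induction_on with
  | _ n ih =>
    rcases n with _ | n
    · simp [hs, ht]
    · have h1 : coeff (n + 1) s * ((n : R) + 1) = coeff (n + 1) t * ((n : R) + 1) := by
        rw [← coeff_derivative, ← coeff_derivative, hs', ht', coeff_mul, coeff_mul]
        refine sum_congr rfl fun p hp => ?_
        rw [ih p.2 (by have := mem_antidiagonal.1 hp; omega)]
      have hu : IsUnit ((n : R) + 1) := by
        have : ((n : R) + 1) = algebraMap ℚ R (n + 1) := by simp
        rw [this]
        exact (IsUnit.mk0 _ (by positivity)).map _
      exact hu.mul_right_cancel h1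

theorem PowerSeries.exists_logDerivative_eq {R : Type*} [CommRing R] [Algebra ℚ R] (L : R⟦X⟧) :
    ∃ s : R⟦X⟧, constantCoeff s = 1 ∧ s.logDerivative = L := by
  set M : R⟦X⟧ := PowerSeries.mk fun n => ((n : ℚ)⁻¹) • coeff (n - 1) L with hM
  have hM0 : constantCoeff M = 0 := by
    rw [← coeff_zero_eq_constantCoeff_apply, hM, coeff_mk]; simp
  have hMd : d⁄dX R M = L := by
    ext n
    have : ((n : R) + 1) = algebraMap ℚ R (n + 1) := by simp
    rw [coeff_derivative, hM, coeff_mk, this, mul_comm, ← Algebra.smul_def, smul_smul]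
    have h0 : ((n : ℚ) + 1) ≠ 0 := by positivity
    push_cast
    rw [mul_inv_cancel₀ h0, one_smul]
  have hs := HasSubst.of_constantCoeff_zero' hM0
  have hc : constantCoeff ((exp R).subst M) = 1 := by
    have h1 : (exp R).subst M = 1 + (exp R - 1).subst M := by
      rw [← coe_substAlgHom hs, map_sub, map_one]; ring
    have h2 : constantCoeff ((exp R - 1).subst M) = 0 :=
      constantCoeff_subst_eq_zero hM0 _ (by simp)
    rw [h1, map_add, map_one, h2, add_zero]
  refine ⟨(exp R).subst M, hc, logDerivative_unique hc ?_⟩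
  rw [derivative_subst hs, derivative_exp, hMd, mul_comm]

namespace GOnePlus

/-- The coefficients of the logarithmic derivative of the `S`-transform. -/
noncomputable def toGaN {R : Type*} [CommRing R] (f : GOnePlus R) : GaN R :=
  Multiplicative.ofAdd fun n => coeff n f.sTransform.logDerivative

theorem toGaN_mul {R : Type*} [CommRing R] (f g : GOnePlus R) :
    (f * g).toGaN = f.toGaN * g.toGaN := by
  apply Multiplicative.toAdd.injective
  funext n
  simp [toGaN, sTransform_mul,
    logDerivative_mul f.constantCoeff_sTransform g.constantCoeff_sTransform]

theorem toGaN_identity (R : Type*) [CommRing R] : (identity R).toGaN = 1 := by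
  have : (1 : R⟦X⟧).logDerivative = 0 := logDerivative_unique (by simp) (by simp)
  apply Multiplicative.toAdd.injective
  funext n
  simp [toGaN, sTransform_identity, this]

theorem toGaN_map {R : Type u} {S : Type v} [CommRing R] [CommRing S] (φ : R →+* S)
    (f : GOnePlus R) (n : ℕ) : (map φ f).toGaN.toAdd n = φ (f.toGaN.toAdd n) := by
  simp [toGaN, sTransform_map, logDerivative_map φ f.constantCoeff_sTransform]

theorem toGaN_bijective (R : Type*) [CommRing R] [Algebra ℚ R] :
    Function.Bijective (toGaN (R := R)) := by
  constructor
  · intro f g h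
    refine sTransform_injective (eq_of_logDerivative_eq f.constantCoeff_sTransform
      g.constantCoeff_sTransform (PowerSeries.ext fun n => ?_))
    exact congrFun (congrArg Multiplicative.toAdd h) n
  · intro a
    obtain ⟨s, hs, hL⟩ := exists_logDerivative_eq (PowerSeries.mk a.toAdd)
    obtain ⟨f, rfl⟩ := exists_sTransform_eq hs
    refine ⟨f, Multiplicative.toAdd.injective (funext fun n => ?_)⟩
    simp [toGaN, hL]

/-- The isomorphism of `𝔊¹₊(R)` with the additive group of sequences. -/
noncomputable def equivGaN (R : Type*) [CommRing R] [Algebra ℚ R] : GOnePlus R ≃* GaN R :=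
  MulEquiv.mk' (Equiv.ofBijective toGaN (toGaN_bijective R)) toGaN_mul

theorem equivGaN_map {R : Type u} {S : Type v} [CommRing R] [Algebra ℚ R] [CommRing S]
    [Algebra ℚ S] (φ : R →+* S) (f : GOnePlus R) (n : ℕ) :
    (equivGaN S (map φ f)).toAdd n = φ ((equivGaN R f).toAdd n) :=
  toGaN_map φ f n

theorem equivGaN_symm_map {R : Type u} {S : Type v} [CommRing R] [Algebra ℚ R] [CommRing S]
    [Algebra ℚ S] (φ : R →+* S) (a : GaN R) :
    (equivGaN S).symm (Multiplicative.ofAdd fun n => φ (a.toAdd n)) =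
      map φ ((equivGaN R).symm a) := by
  rw [MulEquiv.symm_apply_eq]
  apply Multiplicative.toAdd.injective
  funext n
  rw [equivGaN_map, MulEquiv.apply_symm_apply]
  rfl

/-- The group structure on `𝔊¹₊(R)`. -/
noncomputable abbrev commGroup (R : Type*) [CommRing R] [Algebra ℚ R] : CommGroup (GOnePlus R) :=
  (equivGaN R).toEquiv.commGroup

/-- The series with the given coordinates. -/
noncomputable def ofCoords {R : Type*} [CommRing R] (r : ℕ → R) : GOnePlus R :=
  ⟨X + X ^ 2 * PowerSeries.mk r, by simp, by simp [coeff_X_pow_mul']⟩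

theorem coords_ofCoords {R : Type*} [CommRing R] (r : ℕ → R) : (ofCoords r).coords = r := by
  funext n
  simp [coords, ofCoords, coeff_X_pow_mul', coeff_X]

theorem coords_map {R : Type u} {S : Type v} [CommRing R] [CommRing S] (φ : R →+* S)
    (f : GOnePlus R) (n : ℕ) : (map φ f).coords n = φ (f.coords n) := by
  simp [coords, map]

end GOnePlus

theorem mainTheorem3 :
    -- boxed convolution makes `𝔊¹₊(R)` a commutative group with neutral element `z`
    (∀ (R : Type u) [CommRing R] [Algebra ℚ R],
      ∃ G : CommGroup (GOnePlus R),
        (∀ f g : GOnePlus R, (G.mul f g).1 = boxedConv f.1 g.1) ∧ G.one.1 = PowerSeries.X) ∧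
    -- there are isomorphisms
    ∃ e : ∀ (R : Type u) [CommRing R] [Algebra ℚ R], GOnePlus R ≃* GaN R,
      -- natural in the `ℚ`-algebra `R`
      (∀ (R S : Type u) [CommRing R] [Algebra ℚ R] [CommRing S] [Algebra ℚ S] (φ : R →ₐ[ℚ] S)
        (f : GOnePlus R) (n : ℕ),
        (e S (GOnePlus.map (φ : R →+* S) f)).toAdd n = φ ((e R f).toAdd n)) ∧
      -- given in both directions by polynomials over `ℚ` that do not depend on `R`
      ∃ Φ Ψ : ℕ → MvPolynomial ℕ ℚ,
        ∀ (R : Type u) [CommRing R] [Algebra ℚ R],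
          (∀ (f : GOnePlus R) (n : ℕ),
            (e R f).toAdd n = MvPolynomial.aeval f.coords (Φ n)) ∧
          (∀ (a : GaN R) (n : ℕ),
            ((e R).symm a).coords n = MvPolynomial.aeval a.toAdd (Ψ n)) := by
  refine ⟨fun R _ _ => ⟨GOnePlus.commGroup R, fun f g => ?_, ?_⟩, fun R _ _ => GOnePlus.equivGaN R,
    fun R S _ _ _ _ φ f n => GOnePlus.equivGaN_map _ f n,
    fun n => (GOnePlus.equivGaN _ (GOnePlus.ofCoords MvPolynomial.X)).toAdd n,
    fun n => ((GOnePlus.equivGaN _).symm (Multiplicative.ofAdd MvPolynomial.X)).coords n,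
    fun R _ _ => ⟨fun f n => ?_, fun a n => ?_⟩⟩
  · have : (GOnePlus.commGroup R).mul f g = f * g := by
      change (GOnePlus.equivGaN R).symm (GOnePlus.equivGaN R f * GOnePlus.equivGaN R g) = f * g
      rw [MulEquiv.symm_apply_eq, map_mul]
    rw [this]
    rfl
  · have : (GOnePlus.commGroup R).one = GOnePlus.identity R := by
      change (GOnePlus.equivGaN R).symm 1 = _
      rw [MulEquiv.symm_apply_eq]
      exact (GOnePlus.toGaN_identity R).symm
    rw [this]
    rfl
  · have hf : GOnePlus.map (MvPolynomial.aeval f.coords : MvPolynomial ℕ ℚ →ₐ[ℚ] R).toRingHom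
        (GOnePlus.ofCoords MvPolynomial.X) = f := by
      apply GOnePlus.ext_coords
      funext k
      rw [GOnePlus.coords_map, GOnePlus.coords_ofCoords]
      exact MvPolynomial.aeval_X _ _
    have := GOnePlus.equivGaN_map
      (MvPolynomial.aeval f.coords : MvPolynomial ℕ ℚ →ₐ[ℚ] R).toRingHom
      (GOnePlus.ofCoords MvPolynomial.X) n
    rw [hf] at this
    exact this
  · have := GOnePlus.equivGaN_symm_map
      (MvPolynomial.aeval a.toAdd : MvPolynomial ℕ ℚ →ₐ[ℚ] R).toRingHom
      (Multiplicative.ofAdd MvPolynomial.X)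
    have ha : (Multiplicative.ofAdd fun k =>
        (MvPolynomial.aeval a.toAdd : MvPolynomial ℕ ℚ →ₐ[ℚ] R).toRingHom
          ((Multiplicative.ofAdd (MvPolynomial.X : ℕ → MvPolynomial ℕ ℚ)).toAdd k)) = a := by
      apply Multiplicative.toAdd.injective
      funext k
      exact MvPolynomial.aeval_X _ _
    rw [ha] at this
    rw [this, GOnePlus.coords_map]
    rfl
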